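/- Let $(R,\mathfrak m,k)$ be a commutative noetherian local ring with residue field $k=R/\mathfrak m$, and let $N$ be a finitely generated $R$-module. Let $F\to k$ and $G\to N$ be projective resolutions over $R$. Let $\operatorname{Hom}_R(F,G)$ be the complex whose component of cohomological degree $n$ is $\prod_{i}\operatorname{Hom}_R(F_i,G_{i-n})$, with differential $\partial(\beta)=\partial^G\beta-(-1)^{|\beta|}\beta\partial^F$, and let $\overline{\operatorname{Hom}}_R(F,G)$ be its subcomplex of bounded homomorphisms, that is, of those $\beta=(\beta_i)_i$ with $\beta_i=0$ for all $i\gg0$. The stable cohomology of $k$ and $N$ is $$\widehat{\operatorname{Ext}}{}^n_R(k,N)=\operatorname{H}^n\bigl(\operatorname{Hom}_R(F,G)/\overline{\operatorname{Hom}}_R(F,G)\bigr)\qquad(n\in\mathbb Z);$$ it is annihilated by $\mathfrak m$, hence is a $k$-vector space. If the $k$-vector space $\widehat{\operatorname{Ext}}{}^n_R(k,N)$ is finite-dimensional for some $n\in\mathbb Z$, then $N$ has finite projective dimension over $R$, or $R$ is Gorenstein (that is, $R$ has finite injective dimension as a module over itself). -/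

import Mathlib

open CategoryTheory

universe u

namespace StableCohomology

open CochainComplex.HomComplex

section Complexes

variable {R : Type u} [CommRing R] (F G : CochainComplex (ModuleCat.{u} R) ℤ)

/-- The submodule of bounded cochains `β = (β_i : F_i → G_{i-n})_i` of cohomological degree `n`:
those with `β_i = 0` for all homological indices `i ≫ 0`.  The component `β_i` is
`β.v p (p + n)` with `p = -i`, hence the condition concerns all `p ≪ 0`. -/
def boundedCochains (n : ℤ) : Submodule R (Cochain F G n) where
  carrier := {β | ∃ b : ℤ, ∀ (p q : ℤ) (hpq : p + n = q), p ≤ b → β.v p q hpq = 0}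
  add_mem' := by
    rintro β γ ⟨b, hb⟩ ⟨c, hc⟩
    refine ⟨min b c, fun p q hpq hp => ?_⟩
    rw [Cochain.add_v, hb p q hpq (hp.trans (min_le_left _ _)),
      hc p q hpq (hp.trans (min_le_right _ _)), add_zero]
  zero_mem' := ⟨0, fun _ _ _ _ => rfl⟩
  smul_mem' := by
    rintro r β ⟨b, hb⟩
    refine ⟨b, fun p q hpq hp => ?_⟩
    rw [Cochain.smul_v, hb p q hpq hp, smul_zero]

/-- The bounded cochains form a subcomplex of the complex of all cochains. -/
theorem boundedCochains_le_comap (n m : ℤ) :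
    boundedCochains F G n ≤ (boundedCochains F G m).comap (δ_hom R F G n m) := by
  rintro β ⟨b, hb⟩
  change δ n m β ∈ boundedCochains F G m
  by_cases hnm : n + 1 = m
  · refine ⟨b - 1, fun p q hpq hp => ?_⟩
    rw [δ_v n m hnm β p q hpq (p + n) (p + 1) (by omega) rfl, hb p (p + n) rfl (by omega),
      hb (p + 1) q (by omega) (by omega)]
    simp
  · rw [δ_shape n m hnm]
    exact Submodule.zero_mem _

/-- Degree `n` of the quotient of the complex `Hom(F, G)` by the subcomplex of bounded cochains. -/
abbrev StableCochain (n : ℤ) : Type u := Cochain F G n ⧸ boundedCochains F G n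

/-- The differential of the quotient complex, induced by
`∂β = ∂^G β - (-1)^{|β|} β ∂^F` (it is zero unless `n + 1 = m`). -/
def stableδ (n m : ℤ) : StableCochain F G n →ₗ[R] StableCochain F G m :=
  (boundedCochains F G n).mapQ (boundedCochains F G m) (δ_hom R F G n m)
    (boundedCochains_le_comap F G n m)

/-- The cocycles of degree `n` in the quotient complex. -/
abbrev stableCocycles (n : ℤ) : Submodule R (StableCochain F G n) :=
  LinearMap.ker (stableδ F G n (n + 1))

/-- The coboundaries of degree `n` in the quotient complex. -/
abbrev stableCoboundaries (n : ℤ) : Submodule R (StableCochain F G n) :=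
  LinearMap.range (stableδ F G (n - 1) n)

theorem stableCoboundaries_le (n : ℤ) : stableCoboundaries F G n ≤ stableCocycles F G n := by
  rintro _ ⟨x, rfl⟩
  obtain ⟨β, rfl⟩ := Submodule.Quotient.mk_surjective _ x
  rw [LinearMap.mem_ker]
  change Submodule.Quotient.mk (δ n (n + 1) (δ (n - 1) n β)) = 0
  rw [δ_δ]
  rfl

/-- The cohomology in degree `n` of the quotient complex: cocycles modulo coboundaries. -/
abbrev StableHomology (n : ℤ) : Type u :=
  stableCocycles F G n ⧸ (stableCoboundaries F G n).submoduleOf (stableCocycles F G n)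

end Complexes

section Modules

variable {R : Type u} [CommRing R] {M N : ModuleCat.{u} R}

/-- Vogel's stable cohomology `Êxt^n_R(M, N)`, computed from projective resolutions
`P → M` and `Q → N`. -/
def StableExt (P : ProjectiveResolution M) (Q : ProjectiveResolution N) (n : ℤ) : Type u :=
  StableHomology P.cochainComplex Q.cochainComplex n

variable (P : ProjectiveResolution M) (Q : ProjectiveResolution N) (n : ℤ)

noncomputable instance : AddCommGroup (StableExt P Q n) :=
  inferInstanceAs (AddCommGroup (StableHomology P.cochainComplex Q.cochainComplex n))

noncomputable instance : Module R (StableExt P Q n) :=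
  inferInstanceAs (Module R (StableHomology P.cochainComplex Q.cochainComplex n))

/-- If `r` annihilates `M`, multiplication by `r` on a projective resolution of `M` is
null-homotopic. -/
theorem exists_δ_eq_smul (r : R) (hr : ∀ m : M, r • m = 0) :
    ∃ h : Cochain P.cochainComplex P.cochainComplex (-1),
      δ (-1) 0 h = r • Cochain.ofHom (𝟙 P.cochainComplex) := by
  have hM : r • 𝟙 M = 0 := by
    ext m
    exact hr m
  have hπ : (r • 𝟙 P.complex) ≫ P.π = 0 := by
    have hM' : P.π ≫ (ChainComplex.single₀ _).map (r • 𝟙 M) = 0 := by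
      rw [hM, Functor.map_zero, Limits.comp_zero]
    rw [← hM']
    refine HomologicalComplex.to_single_hom_ext ?_
    rw [HomologicalComplex.comp_f, HomologicalComplex.comp_f, ChainComplex.single₀_map_f_zero]
    ext x
    exact (P.π.f 0).hom.map_smul r x
  let φ : P.cochainComplex ⟶ P.cochainComplex :=
    HomologicalComplex.extendMap (r • 𝟙 P.complex) ComplexShape.embeddingDownNat
  have hφ : (0 : P.cochainComplex ⟶ P.cochainComplex) =
      HomologicalComplex.extendMap (0 : P.complex ⟶ P.complex) ComplexShape.embeddingDownNat :=
    (HomologicalComplex.extendMap_zero _ _ _).symm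
  let H : Homotopy φ 0 := (Homotopy.extend (ProjectiveResolution.liftHomotopyZero _ hπ)
    ComplexShape.embeddingDownNat).trans (Homotopy.ofEq hφ.symm)
  refine ⟨Cochain.ofHomotopy H, ?_⟩
  rw [δ_ofHomotopy, Cochain.ofHom_zero, sub_zero]
  refine Cochain.ext₀ _ _ fun p => ?_
  rw [Cochain.smul_v, Cochain.ofHom_v, Cochain.ofHom_v]
  by_cases hp : ∃ i : ℕ, ComplexShape.embeddingDownNat.f i = p
  · obtain ⟨i, hi⟩ := hp
    rw [HomologicalComplex.extendMap_f _ _ hi]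
    simp
    rfl
  · have hz := HomologicalComplex.isZero_extend_X P.complex ComplexShape.embeddingDownNat p
      (fun i hi => hp ⟨i, hi⟩)
    exact hz.eq_of_src _ _

/-- An element of `R` that annihilates `M` annihilates the stable cohomology of `M` and `N`. -/
theorem smul_stableExt_eq_zero (r : R) (hr : ∀ m : M, r • m = 0) (x : StableExt P Q n) :
    r • x = 0 := by
  obtain ⟨h, hh⟩ := exists_δ_eq_smul P r hr
  obtain ⟨⟨y, hy⟩, rfl⟩ := Submodule.Quotient.mk_surjective _ x
  obtain ⟨z, rfl⟩ := Submodule.Quotient.mk_surjective _ y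
  have hz : δ n (n + 1) z ∈ boundedCochains P.cochainComplex Q.cochainComplex (n + 1) :=
    (Submodule.Quotient.mk_eq_zero _).1 (LinearMap.mem_ker.1 hy)
  obtain ⟨b, hb⟩ := hz
  let c : stableCocycles P.cochainComplex Q.cochainComplex n := ⟨Submodule.Quotient.mk z, hy⟩
  refine (Submodule.Quotient.mk_eq_zero
    ((stableCoboundaries P.cochainComplex Q.cochainComplex n).submoduleOf _)
    (x := r • c)).2 ?_
  rw [Submodule.submoduleOf, Submodule.mem_comap]
  refine ⟨Submodule.Quotient.mk (n.negOnePow • h.comp z (by omega)), ?_⟩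
  change Submodule.Quotient.mk (δ (n - 1) n (n.negOnePow • h.comp z _)) =
    Submodule.Quotient.mk (r • z)
  rw [Submodule.Quotient.eq, δ_units_smul,
    δ_comp h z (by omega : -1 + n = n - 1) 0 (n + 1) n (by omega) (by omega) rfl, hh, smul_add,
    smul_smul, ← Int.negOnePow_add, Int.negOnePow_even _ (⟨n, rfl⟩), one_smul]
  have e : (r • Cochain.ofHom (𝟙 P.cochainComplex)).comp z (zero_add n) = r • z := by
    rw [Cochain.smul_comp, Cochain.id_comp]
  rw [e, add_sub_cancel_right]
  refine ⟨b, fun p q hpq hp => ?_⟩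
  rw [Cochain.units_smul_v, Cochain.comp_v _ _ _ p (p - 1) q (by omega) (by omega),
    hb (p - 1) q (by omega) (by omega), Limits.comp_zero, smul_zero]

end Modules

section ResidueField

variable {R : Type u} [CommRing R] [IsLocalRing R] {N : ModuleCat.{u} R}
  (P : ProjectiveResolution (ModuleCat.of R (IsLocalRing.ResidueField R)))
  (Q : ProjectiveResolution N) (n : ℤ)

theorem isTorsionBySet_stableExt :
    Module.IsTorsionBySet R (StableExt P Q n) (IsLocalRing.maximalIdeal R) := by
  rintro x ⟨r, hr⟩
  refine smul_stableExt_eq_zero P Q n r (fun m => ?_) x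
  change r • (m : IsLocalRing.ResidueField R) = 0
  rw [Algebra.smul_def, IsLocalRing.ResidueField.algebraMap_eq,
    (IsLocalRing.residue_eq_zero_iff r).2 hr, zero_mul]

/-- The `R`-module `Êxt^n_R(k, N)` is a vector space over the residue field `k = R/𝔪`:
the class of `r` acts as `r`. -/
noncomputable instance : Module (IsLocalRing.ResidueField R) (StableExt P Q n) :=
  (isTorsionBySet_stableExt P Q n).module

theorem residue_smul_stableExt (r : R) (x : StableExt P Q n) :
    IsLocalRing.residue R r • x = r • x :=
  rfl

end ResidueField

end StableCohomology

/-- A noetherian local ring is Gorenstein if it has finite injective dimension as a module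
over itself. -/
def IsGorensteinLocalRing (R : Type u) [CommRing R] [IsLocalRing R] [IsNoetherianRing R] : Prop :=
  ∃ d : ℕ, HasInjectiveDimensionLE (ModuleCat.of R R) d

/-- `N` has finite projective dimension over `R`. -/
def HasFiniteProjectiveDimension (R : Type u) [CommRing R] (N : Type u) [AddCommGroup N]
    [Module R N] : Prop :=
  ∃ d : ℕ, HasProjectiveDimensionLE (ModuleCat.of R N) d

/-! Write $F\to k$ for the given resolution and $G\to N$ for a minimal free one; position $p$ means
homological index $-p$. Assume $N$ has infinite projective dimension, so that every $G_j\ne0$, and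
that $R$ is not Gorenstein, so that $\operatorname{Ext}^i_R(k,R)\ne0$ for arbitrarily large $i$. The
exact sequence $\widehat{\operatorname{Ext}}{}^n\to
H^{n+1}(\overline{\operatorname{Hom}}(F,G))\to\operatorname{Ext}^{n+1}(k,N)$ has a finitely
generated right end. If the left end is also of finite length, the middle term is too, and this is
contradicted by producing a new class for each large $i$ with $\operatorname{Ext}^i(k,R)\ne0$.

The classes come from an extension principle (`exists_cocycle_of_functional`): if $\varphi:F_i\to R$
is a cocycle and $e\in G_j$, then $x\mapsto\varphi(x)e$ is the component of a bounded cocycle that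
vanishes on $F_l$ for $l>i$. Minimality is essential: $\partial e\in\mathfrak mG$, and
multiplication by an element of $\mathfrak m$ is null-homotopic on $F$, so
$\mathrm{id}\otimes\partial e$ is a boundary in $\operatorname{Hom}(F,F)\otimes G$. Later
corrections exist because $\operatorname{Hom}(F,F)$ is exact in negative degrees and $G$ is flat,
and they stop because $G$ does.

The same principle shows that a boundary of a bounded cochain that starts in $F_i$ has a coboundary
as its component there (`exists_d_comp_eq_of_bounded`). If $\varphi$ is not a coboundary and $e$ is
a basis element, the new class thus cannot be moved off $F_i$ by bounded cochains. The finiteness of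
the two outer terms, used as stabilization of filtrations by support, says that it can
(`exists_hasUniformBound`, `false_of_hasUniformBound`). -/

namespace StableCohomology

open CategoryTheory.Abelian

/-! ### Injective dimension tested on cyclic modules -/

section InjectiveDimension

variable {R : Type u} [CommRing R]

/-- Baer's criterion: the obstruction to extending a map from $I$ to $R$ lies in
$\operatorname{Ext}^1(R/I,X)$. -/
theorem injective_of_subsingleton_ext_one (X : ModuleCat.{u} R)
    (h : ∀ I : Ideal R, Subsingleton (Ext (ModuleCat.of R (R ⧸ I)) X 1)) : Injective X := by
  rw [← Module.injective_iff_injective_object, ← Module.Baer.iff_injective]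
  intro I g
  have hS := LinearMap.shortExact_shortComplexKer (Submodule.mkQ_surjective I)
  have e : I = LinearMap.ker I.mkQ := by simp
  let g' : ModuleCat.of R (LinearMap.ker I.mkQ) ⟶ X :=
    ModuleCat.ofHom (g ∘ₗ (LinearEquiv.ofEq _ _ e.symm).toLinearMap)
  have := h I
  obtain ⟨φ, hφ⟩ := Ext.contravariant_sequence_exact₁ hS X (Ext.mk₀ g') (add_zero 1)
    (Subsingleton.elim (α := Ext (ModuleCat.of R (R ⧸ I)) X 1) _ _)
  obtain ⟨f, rfl⟩ := Ext.homEquiv₀.symm.surjective φ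
  simp only [Ext.homEquiv₀_symm_apply, Ext.mk₀_comp_mk₀] at hφ
  have hf := (Ext.mk₀_bijective _ _).1 hφ
  refine ⟨f.hom, fun x hx => ?_⟩
  have := congr($hf ⟨x, e ▸ hx⟩)
  exact this

/-- Dimension shifting along an embedding of $X$ into an injective reduces to Baer's criterion. -/
theorem hasInjectiveDimensionLT_of_subsingleton_ext (n : ℕ) (X : ModuleCat.{u} R)
    (h : ∀ I : Ideal R, Subsingleton (Ext (ModuleCat.of R (R ⧸ I)) X (n + 1))) :
    HasInjectiveDimensionLT X (n + 1) := by
  induction n generalizing X with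
  | zero =>
    have := injective_of_subsingleton_ext_one X h
    infer_instance
  | succ n ih =>
    obtain ⟨E, _, f, _⟩ := EnoughInjectives.presentation X
    let S : ShortComplex (ModuleCat.{u} R) :=
      ShortComplex.mk f (Limits.cokernel.π f) (Limits.cokernel.condition f)
    have hS : S.ShortExact := { exact := ShortComplex.exact_cokernel f }
    have hE : Injective S.X₂ := ‹Injective E›
    refine (hS.hasInjectiveDimensionLT_X₃_iff n hE).1 (ih _ fun I => ⟨fun a b => ?_⟩)
    have := h I
    rw [← sub_eq_zero]
    obtain ⟨y, hy⟩ := Ext.covariant_sequence_exact₃ _ hS (a - b) rfl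
      (Subsingleton.elim (α := Ext (ModuleCat.of R (R ⧸ I)) X (n + 1 + 1)) _ _)
    rw [← hy, Ext.eq_zero_of_injective y, Ext.zero_comp]

/-- Here $J=(I:a)$. Keeping $J$ as a variable allows $J=I$ when $I$ is prime and $a\notin I$. -/
theorem exact_mapQ_mulLeft_factor (I J : Ideal R) (a : R) (hJ : ∀ x, x ∈ J ↔ a * x ∈ I) :
    (ShortComplex.mk (ModuleCat.ofHom (J.mapQ I (LinearMap.mulLeft R a) fun x hx => (hJ x).1 hx))
      (ModuleCat.ofHom (Submodule.factor (le_sup_left : I ≤ I ⊔ Ideal.span {a}))) (by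
        ext
        exact (Submodule.Quotient.mk_eq_zero _).2 (Ideal.mul_mem_right _ _
          (Ideal.mem_sup_right (Ideal.mem_span_singleton_self a))))).ShortExact := by
  refine ModuleCat.shortComplex_shortExact _ ?_ ?_ ?_
  · intro x
    obtain ⟨x, rfl⟩ := Submodule.Quotient.mk_surjective _ x
    constructor
    · intro hx
      obtain ⟨y, hy, z, hz, rfl⟩ := Submodule.mem_sup.1 ((Submodule.Quotient.mk_eq_zero _).1 hx)
      obtain ⟨c, rfl⟩ := Ideal.mem_span_singleton'.1 hz
      refine ⟨Submodule.Quotient.mk c, ?_⟩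
      change Submodule.Quotient.mk (a * c) = _
      rw [Submodule.Quotient.eq, mul_comm, sub_add_cancel_right]
      exact I.neg_mem hy
    · rintro ⟨y, hy⟩
      obtain ⟨y, rfl⟩ := Submodule.Quotient.mk_surjective _ y
      rw [← hy]
      exact (Submodule.Quotient.mk_eq_zero _).2 (Ideal.mul_mem_right _ _
          (Ideal.mem_sup_right (Ideal.mem_span_singleton_self a)))
  · refine (injective_iff_map_eq_zero _).2 fun x hx => ?_
    obtain ⟨x, rfl⟩ := Submodule.Quotient.mk_surjective _ x
    exact (Submodule.Quotient.mk_eq_zero _).2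
      ((hJ x).2 ((Submodule.Quotient.mk_eq_zero _).1 hx))
  · exact Submodule.factor_surjective le_sup_left

end InjectiveDimension

/-! ### Nonvanishing of $\operatorname{Ext}^i(k,R)$ over a non-Gorenstein ring -/

section Local

variable {R : Type u} [CommRing R] [IsLocalRing R] [IsNoetherianRing R]

/-- Noetherian induction on $I$. For $I$ prime and not maximal, take $a\in\mathfrak m\setminus I$:
vanishing for $I+(a)$ in degree $i+1$ makes $a$ surjective on the finitely generated
$\operatorname{Ext}^i(R/I,X)$, and Nakayama applies. For $I$ proper and not prime, $ab\in I$ places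
$R/I$ between quotients by the larger ideals $(I:a)$ and $I+(a)$. -/
theorem subsingleton_ext_quotient (X : ModuleCat.{u} R) [Module.Finite R X] (i₀ : ℕ)
    (h : ∀ i, i₀ ≤ i → Subsingleton (Ext (ModuleCat.of R (IsLocalRing.ResidueField R)) X i))
    (I : Ideal R) : ∀ i, i₀ ≤ i → Subsingleton (Ext (ModuleCat.of R (R ⧸ I)) X i) := by
  induction I using IsNoetherian.induction with
  | hgt I' ih =>
  intro i hi
  let I : Ideal R := I'
  change Subsingleton (Ext (ModuleCat.of R (R ⧸ I)) X i)
  replace ih : ∀ J : Ideal R, I < J → ∀ i, i₀ ≤ i →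
    Subsingleton (Ext (ModuleCat.of R (R ⧸ J)) X i) := ih
  clear_value I
  have hlt (a : R) (ha : a ∉ I) : I < I ⊔ Ideal.span {a} :=
    lt_of_le_of_ne le_sup_left fun e => ha
      (e ▸ Ideal.mem_sup_right (Ideal.mem_span_singleton_self a))
  by_cases hp : I.IsPrime
  · by_cases hm : I = IsLocalRing.maximalIdeal R
    · subst hm
      exact h i hi
    obtain ⟨a, ham, haI⟩ := SetLike.exists_of_lt
      (lt_of_le_of_ne (IsLocalRing.le_maximalIdeal hp.ne_top) hm)
    have hS := exact_mapQ_mulLeft_factor I I a fun x =>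
      ⟨fun hx => I.mul_mem_left _ hx, fun hx => (hp.mem_or_mem hx).resolve_left haI⟩
    have hle : (⊤ : Submodule R (Ext (ModuleCat.of R (R ⧸ I)) X i)) ≤
        IsLocalRing.maximalIdeal R • ⊤ := by
      intro x _
      have := ih _ (hlt a haI) (1 + i) (by omega)
      obtain ⟨y, hy⟩ := Ext.contravariant_sequence_exact₁ hS X x rfl
        (Subsingleton.elim (α := Ext (ModuleCat.of R (R ⧸ (I ⊔ Ideal.span {a}))) X (1 + i)) _ _)
      have e : a • y = x := by
        rw [← hy, ← Ext.mk₀_id_comp y, ← Ext.smul_comp, ← Ext.mk₀_smul, Ext.mk₀_id_comp]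
        congr 2
      rw [← e]
      exact Submodule.smul_mem_smul ham trivial
    have hbot := Submodule.eq_bot_of_le_smul_of_le_jacobson_bot _ _ (Module.Finite.fg_top)
      hle (IsLocalRing.maximalIdeal_le_jacobson _)
    exact (Submodule.subsingleton_iff R).1 (subsingleton_of_bot_eq_top hbot.symm)
  · by_cases htop : I = ⊤
    · have : Subsingleton (R ⧸ I) := by
        rw [htop]
        infer_instance
      have hz := ModuleCat.isZero_of_subsingleton (ModuleCat.of R (R ⧸ I))
      exact ⟨fun x y => by
        rw [← Ext.mk₀_id_comp x, ← Ext.mk₀_id_comp y, hz.eq_of_src (𝟙 _) 0, Ext.mk₀_zero,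
          Ext.zero_comp, Ext.zero_comp]⟩
    rw [Ideal.isPrime_iff] at hp
    push Not at hp
    obtain ⟨a, b, hab, ha, hb⟩ := hp htop
    have hS := exact_mapQ_mulLeft_factor I (Submodule.comap (LinearMap.mulLeft R a) I) a fun x => Iff.rfl
    have h₃ := ih _ (hlt a ha) i hi
    have h₁ := ih (Submodule.comap (LinearMap.mulLeft R a) I)
      (lt_of_le_of_ne (fun x hx => I.mul_mem_left _ hx) fun e => hb (by rw [e]; exact hab)) i hi
    refine ⟨fun x y => ?_⟩
    rw [← sub_eq_zero]
    obtain ⟨z, hz⟩ := Ext.contravariant_sequence_exact₂ hS X (x - y)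
      (Subsingleton.elim (α := Ext (ModuleCat.of R (R ⧸ (Submodule.comap (LinearMap.mulLeft R a) I))) X i)
        _ _)
    rw [← hz, Subsingleton.elim (α := Ext (ModuleCat.of R (R ⧸ (I ⊔ Ideal.span {a}))) X i) z 0,
      Ext.comp_zero]

theorem exists_nontrivial_ext_of_not_gorenstein (hR : ¬ IsGorensteinLocalRing R) (i₀ : ℕ) :
    ∃ i, i₀ ≤ i ∧ Nontrivial
      (Ext (ModuleCat.of R (IsLocalRing.ResidueField R)) (ModuleCat.of R R) i) := by
  by_contra! hc
  refine hR ⟨i₀, hasInjectiveDimensionLT_of_subsingleton_ext _ _ fun I =>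
    subsingleton_ext_quotient _ i₀ (fun i hi => ?_) I _ (Nat.le_succ _)⟩
  simpa [not_nontrivial_iff_subsingleton] using hc i hi

end Local
end StableCohomology

namespace StableCohomology

/-! ### Minimal free resolutions -/

section MinimalResolution

variable {R : Type u} [CommRing R] [IsLocalRing R]

open IsLocalRing TensorProduct in
-- Lift a basis of $k\otimes M$. Nakayama gives generation; independence over $k$ puts the
-- coefficients of every relation in $\mathfrak m$.
theorem exists_minimal_cover (M : Type u) [AddCommGroup M] [Module R M] [Module.Finite R M] :
    ∃ (b : ℕ) (f : (Fin b → R) →ₗ[R] M), Function.Surjective f ∧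
      LinearMap.ker f ≤ maximalIdeal R • ⊤ := by
  let w := Module.finBasis (ResidueField R) (ResidueField R ⊗[R] M)
  obtain ⟨v, hv⟩ := (TensorProduct.mk_surjective R M (ResidueField R)
    Ideal.Quotient.mk_surjective).comp_left w
  refine ⟨_, Fintype.linearCombination R v, ?_, fun x hx => ?_⟩
  · rw [← LinearMap.range_eq_top, Fintype.range_linearCombination]
    exact span_eq_top_of_tmul_eq_basis v w (congr_fun hv)
  · have hx' : ∑ i, residue R (x i) • w i = 0 := by
      have := congr((1 : ResidueField R) ⊗ₜ[R] $(LinearMap.mem_ker.1 hx))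
      rw [Fintype.linearCombination_apply, tmul_sum, tmul_zero] at this
      rw [← this]
      refine Finset.sum_congr rfl fun i _ => ?_
      rw [← congr_fun hv i, tmul_smul, ← algebraMap_smul (ResidueField R) (x i)]
      rfl
    have hm (i) : x i ∈ maximalIdeal R :=
      (residue_eq_zero_iff _).1 (Fintype.linearIndependent_iff.1 w.linearIndependent _ hx' i)
    rw [pi_eq_sum_univ' x]
    exact Submodule.sum_mem _ fun i _ => Submodule.smul_mem_smul (hm i) trivial

/-- The rank of a minimal free cover. -/
noncomputable def coverRank (M : Type u) [AddCommGroup M] [Module R M] [Module.Finite R M] : ℕ :=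
  (exists_minimal_cover (R := R) M).choose

/-- A minimal free cover. -/
noncomputable def cover (M : Type u) [AddCommGroup M] [Module R M] [Module.Finite R M] :
    (Fin (coverRank (R := R) M) → R) →ₗ[R] M :=
  (exists_minimal_cover (R := R) M).choose_spec.choose

theorem cover_surjective (M : Type u) [AddCommGroup M] [Module R M] [Module.Finite R M] :
    Function.Surjective (cover (R := R) M) :=
  (exists_minimal_cover (R := R) M).choose_spec.choose_spec.1

theorem ker_cover_le (M : Type u) [AddCommGroup M] [Module R M] [Module.Finite R M] :
    LinearMap.ker (cover (R := R) M) ≤ IsLocalRing.maximalIdeal R • ⊤ :=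
  (exists_minimal_cover (R := R) M).choose_spec.choose_spec.2

variable [IsNoetherianRing R] (N : Type u) [AddCommGroup N] [Module R N] [Module.Finite R N]

/-- The syzygies of a finitely generated module, with respect to minimal free covers. -/
noncomputable def syzygy : ℕ → {M : ModuleCat.{u} R // Module.Finite R M}
  | 0 => ⟨ModuleCat.of R N, inferInstance⟩
  | n + 1 =>
    haveI := (syzygy n).2
    ⟨ModuleCat.of R (LinearMap.ker (cover (R := R) (syzygy n).1)),
      Module.Finite.of_fg (IsNoetherian.noetherian _)⟩

instance (n : ℕ) : Module.Finite R (syzygy (R := R) N n).1 := (syzygy N n).2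

/-- The inclusion of a syzygy into the preceding free module. -/
noncomputable def syzygyι (n : ℕ) : (syzygy (R := R) N (n + 1)).1 →ₗ[R]
    (Fin (coverRank (R := R) (syzygy (R := R) N n).1) → R) :=
  (LinearMap.ker (cover (R := R) (syzygy (R := R) N n).1)).subtype

theorem syzygyι_injective (n : ℕ) : Function.Injective (syzygyι (R := R) N n) :=
  Subtype.val_injective

theorem range_syzygyι (n : ℕ) : LinearMap.range (syzygyι (R := R) N n) =
    LinearMap.ker (cover (R := R) (syzygy (R := R) N n).1) :=
  Submodule.range_subtype _

/-- The differential of the minimal free resolution. -/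
noncomputable def minimalD (n : ℕ) :
    (Fin (coverRank (R := R) (syzygy (R := R) N (n + 1)).1) → R) →ₗ[R]
      (Fin (coverRank (R := R) (syzygy (R := R) N n).1) → R) :=
  syzygyι N n ∘ₗ cover (R := R) (syzygy (R := R) N (n + 1)).1

theorem range_minimalD (n : ℕ) : LinearMap.range (minimalD (R := R) N n) =
    LinearMap.ker (cover (R := R) (syzygy (R := R) N n).1) := by
  rw [minimalD, LinearMap.range_comp,
    LinearMap.range_eq_top.2 (cover_surjective (R := R) (syzygy (R := R) N (n + 1)).1),
    Submodule.map_top, range_syzygyι]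

theorem ker_minimalD (n : ℕ) : LinearMap.ker (minimalD (R := R) N n) =
    LinearMap.ker (cover (R := R) (syzygy (R := R) N (n + 1)).1) :=
  LinearMap.ker_comp_of_ker_eq_bot _ (LinearMap.ker_eq_bot.2 (syzygyι_injective N n))

/-- The complex underlying the minimal free resolution. -/
noncomputable def minimalComplex : ChainComplex (ModuleCat.{u} R) ℕ :=
  ChainComplex.of (fun n => ModuleCat.of R (Fin (coverRank (R := R) (syzygy (R := R) N n).1) → R))
    (fun n => ModuleCat.ofHom (minimalD N n)) fun n => by
      rw [← ModuleCat.ofHom_comp]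
      ext1
      refine LinearMap.range_le_ker_iff.1 ?_
      rw [range_minimalD, ker_minimalD]

theorem minimalComplex_d (n : ℕ) :
    (minimalComplex (R := R) N).d (n + 1) n = ModuleCat.ofHom (minimalD N n) := by
  simp [minimalComplex]

theorem minimalComplex_exactAt_succ (n : ℕ) : (minimalComplex (R := R) N).ExactAt (n + 1) := by
  rw [HomologicalComplex.exactAt_iff' _ (n + 1 + 1) (n + 1) n (by simp) (by simp),
    ShortComplex.moduleCat_exact_iff_range_eq_ker]
  change LinearMap.range ((minimalComplex (R := R) N).d (n + 1 + 1) (n + 1)).hom =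
    LinearMap.ker ((minimalComplex (R := R) N).d (n + 1) n).hom
  rw [minimalComplex_d, minimalComplex_d]
  exact (range_minimalD N (n + 1)).trans (ker_minimalD N n).symm

/-- The augmentation of the minimal free resolution. -/
noncomputable def minimalAug : (minimalComplex (R := R) N).X 0 ⟶ ModuleCat.of R N :=
  ModuleCat.ofHom (cover (R := R) (syzygy (R := R) N 0).1)

theorem range_d_eq_ker_minimalAug : LinearMap.range ((minimalComplex (R := R) N).d 1 0).hom =
    LinearMap.ker (minimalAug (R := R) N).hom := by
  rw [minimalComplex_d]
  exact range_minimalD N 0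

theorem d_comp_minimalAug :
    (minimalComplex (R := R) N).d 1 0 ≫ minimalAug (R := R) N = 0 := by
  ext1
  exact LinearMap.range_le_ker_iff.1 (range_d_eq_ker_minimalAug N).le

instance : Epi (minimalAug (R := R) N) :=
  (ModuleCat.epi_iff_surjective _).2 (cover_surjective (syzygy (R := R) N 0).1)

instance (n : ℕ) : Module.Free R ((minimalComplex (R := R) N).X n) :=
  inferInstanceAs (Module.Free R (Fin (coverRank (R := R) (syzygy (R := R) N n).1) → R))

instance (n : ℕ) : Module.Finite R ((minimalComplex (R := R) N).X n) :=
  inferInstanceAs (Module.Finite R (Fin (coverRank (R := R) (syzygy (R := R) N n).1) → R))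

/-- The minimal free resolution of a finitely generated module over a noetherian local ring. -/
noncomputable def minimalResolution : ProjectiveResolution (ModuleCat.of R N) where
  complex := minimalComplex N
  projective n := ModuleCat.projective_of_free (Module.Free.chooseBasis R _)
  π := (ChainComplex.toSingle₀Equiv _ _).symm ⟨minimalAug N, d_comp_minimalAug N⟩
  quasiIso := ⟨fun n => by
    cases n
    · rw [ChainComplex.quasiIsoAt₀_iff, ShortComplex.quasiIso_iff_of_zeros']
      · have h : (ShortComplex.mk _ _ (d_comp_minimalAug (R := R) N)).Exact :=
          (ShortComplex.moduleCat_exact_iff_range_eq_ker _).2 (range_d_eq_ker_minimalAug N)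
        refine (ShortComplex.exact_and_epi_g_iff_of_iso ?_).2
          ⟨h, inferInstanceAs (Epi (minimalAug (R := R) N))⟩
        exact ShortComplex.isoMk (Iso.refl _) (Iso.refl _) (Iso.refl _)
          (by simp; exact (Category.id_comp _).trans (Category.comp_id _).symm)
          (by simp; exact (Category.id_comp _).trans (Category.comp_id _).symm)
      all_goals rfl
    · rw [quasiIsoAt_iff_exactAt']
      · apply minimalComplex_exactAt_succ
      · apply ChainComplex.exactAt_succ_single_obj⟩

theorem minimalResolution_d_mem (n : ℕ) (x : (minimalResolution (R := R) N).complex.X (n + 1)) :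
    (minimalResolution (R := R) N).complex.d (n + 1) n x ∈
      IsLocalRing.maximalIdeal R • (⊤ : Submodule R ((minimalResolution (R := R) N).complex.X n)) := by
  have h : LinearMap.range ((minimalComplex (R := R) N).d (n + 1) n).hom ≤
      IsLocalRing.maximalIdeal R • ⊤ := by
    rw [minimalComplex_d]
    exact (range_minimalD N n).le.trans (ker_cover_le _)
  exact h ⟨x, rfl⟩

theorem hasProjectiveDimensionLT_of_syzygy (n : ℕ)
    (h : HasProjectiveDimensionLT (syzygy (R := R) N n).1 1) :
    HasProjectiveDimensionLT (ModuleCat.of R N) (n + 1) := by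
  suffices ∀ i j, i + j = n → HasProjectiveDimensionLT (syzygy (R := R) N i).1 (j + 1) from
    this 0 n (zero_add n)
  intro i j hij
  induction j generalizing i with
  | zero =>
    obtain rfl : i = n := hij
    exact h
  | succ j ih =>
    have hS := LinearMap.shortExact_shortComplexKer (cover_surjective (R := R) (syzygy (R := R) N i).1)
    refine hS.hasProjectiveDimensionLT_X₃ (j + 1) (ih (i + 1) (by omega)) ?_
    have : Projective (ModuleCat.of R (Fin (coverRank (R := R) (syzygy (R := R) N i).1) → R)) :=
      ModuleCat.projective_of_free (Module.Free.chooseBasis R _)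
    exact hasProjectiveDimensionLT_of_ge
      (ModuleCat.of R (Fin (coverRank (R := R) (syzygy (R := R) N i).1) → R)) 1 _ (by omega)

/-- A zero free cover forces a zero syzygy, and a zero syzygy bounds the projective dimension. -/
theorem nontrivial_minimalResolution_X (hN : ¬ HasFiniteProjectiveDimension R N) (n : ℕ) :
    Nontrivial ((minimalResolution (R := R) N).complex.X n) := by
  by_contra h
  rw [not_nontrivial_iff_subsingleton] at h
  refine hN ⟨n, hasProjectiveDimensionLT_of_syzygy N n ?_⟩
  have : Subsingleton (Fin (coverRank (R := R) (syzygy (R := R) N n).1) → R) := h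
  have : Subsingleton (syzygy (R := R) N n).1 :=
    (cover_surjective (R := R) (syzygy (R := R) N n).1).subsingleton
  have := (ModuleCat.isZero_of_subsingleton (syzygy (R := R) N n).1).projective
  infer_instance

end MinimalResolution
end StableCohomology

namespace StableCohomology

open CochainComplex.HomComplex

/-! ### Solving $\partial w=z$ one position at a time -/

section Lifting

universe v w

variable {C : Type w} [Category.{v} C] [Preadditive C] {F G : CochainComplex C ℤ}

theorem δ_single_v_of_gt {n m p₁ q₁ : ℤ} (hnm : n + 1 = m) (h : F.X p₁ ⟶ G.X q₁)
    (p q : ℤ) (hpq : p + m = q) (hp : p₁ < p) :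
    (δ n m (Cochain.single h n)).v p q hpq = 0 := by
  rw [δ_v n m hnm _ p q hpq (q - 1) (p + 1) rfl rfl,
    Cochain.single_v_eq_zero _ _ _ _ _ (by omega), Cochain.single_v_eq_zero _ _ _ _ _ (by omega)]
  simp

theorem δ_single_v_self {n m p q₁ q : ℤ} (hnm : n + 1 = m) (h : F.X p ⟶ G.X q₁)
    (hq₁ : p + n = q₁) (hpq : p + m = q) :
    (δ n m (Cochain.single h n)).v p q hpq = h ≫ G.d q₁ q := by
  rw [δ_v n m hnm _ p q hpq q₁ (p + 1) (by omega) rfl, Cochain.single_v,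
    Cochain.single_v_eq_zero _ _ _ _ _ (by omega)]
  simp

theorem v_comp_d_eq_zero {m : ℤ} (z : Cochain F G m) (p q q' : ℤ) (hpq : p + m = q)
    (hq : q + 1 = q') (hz : (δ m (m + 1) z).v p q' (by omega) = 0)
    (hz' : z.v (p + 1) q' (by omega) = 0) : z.v p q hpq ≫ G.d q q' = 0 := by
  rw [δ_v m (m + 1) rfl z p q' (by omega) q (p + 1) (by omega) rfl, hz'] at hz
  simpa using hz

end Lifting

section Abelian

universe v w

variable {C : Type w} [Category.{v} C] [Abelian C] {F G : CochainComplex C ℤ}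

theorem exists_lift_of_exactAt {X : C} [Projective X] {q₁ q q₂ : ℤ} (h₁ : q₁ + 1 = q)
    (h₂ : q + 1 = q₂) (hG : G.ExactAt q) (f : X ⟶ G.X q) (hf : f ≫ G.d q q₂ = 0) :
    ∃ g : X ⟶ G.X q₁, g ≫ G.d q₁ q = f := by
  have hG' := (HomologicalComplex.exactAt_iff' _ q₁ q q₂ (by simp; omega) (by simp; omega)).1 hG
  exact ⟨hG'.liftFromProjective f hf, hG'.liftFromProjective_comp f hf⟩

/-- A cocycle with values in a complex that is exact where it matters is a coboundary. -/
theorem exists_δ_eq_of_exactAt [∀ p, Projective (F.X p)] {n m : ℤ} (hnm : n + 1 = m)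
    (z : Cochain F G m) (hz : δ m (m + 1) z = 0) (p₀ : ℤ)
    (hp₀ : ∀ p q hpq, p₀ < p → z.v p q hpq = 0) (hG : ∀ p ≤ p₀, G.ExactAt (p + m)) :
    ∃ w : Cochain F G n, δ n m w = z := by
  let Good (c : ℕ) := {w : Cochain F G n //
    ∀ p q hpq, p₀ - c < p → (δ n m w).v p q hpq = z.v p q hpq}
  -- The remainder $z-\partial w$ is a cocycle that vanishes one position higher, so its component
  -- at $p_0-c$ lands in the kernel of $\partial^G$ and lifts by exactness.
  have step (c : ℕ) (w : Good c) : ∃ w' : Good (c + 1),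
      ∀ p q hpq, p₀ - c < p → w'.1.v p q hpq = w.1.v p q hpq := by
    obtain ⟨w, hw⟩ := w
    have hr : δ m (m + 1) (z - δ n m w) = 0 := by rw [δ_sub, hz, δ_δ, sub_zero]
    obtain ⟨h, hh⟩ := exists_lift_of_exactAt (q₁ := p₀ - c + n) (q₂ := p₀ - c + m + 1)
      (by omega) rfl (hG (p₀ - c) (by omega)) ((z - δ n m w).v (p₀ - c) _ rfl)
      (v_comp_d_eq_zero _ _ _ _ _ rfl (by rw [hr]; rfl)
        (by rw [Cochain.sub_v, hw _ _ _ (by omega), sub_self]))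
    refine ⟨⟨w + Cochain.single h n, fun p q hpq hp => ?_⟩, fun p q hpq hp => ?_⟩
    · rw [δ_add, Cochain.add_v]
      by_cases hpc : p₀ - c < p
      · rw [hw p q hpq hpc, δ_single_v_of_gt hnm h p q hpq hpc, add_zero]
      · obtain rfl : p = p₀ - c := by push_cast at hp; omega
        subst hpq
        rw [δ_single_v_self hnm h rfl, hh, Cochain.sub_v, add_sub_cancel]
    · rw [Cochain.add_v, Cochain.single_v_eq_zero _ _ _ _ _ (by omega), add_zero]
  choose next hnext using step
  let W : ∀ c, Good c := fun c => Nat.rec ⟨0, fun p q hpq hp => by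
    rw [δ_zero, hp₀ p q hpq (by simpa using hp)]; rfl⟩ next c
  have hW (c d : ℕ) (hcd : c ≤ d) (p q hpq) (hp : p₀ - c < p) :
      (W d).1.v p q hpq = (W c).1.v p q hpq := by
    induction d, hcd using Nat.le_induction with
    | base => rfl
    | succ d hd ih => rw [← ih]; exact hnext d (W d) p q hpq (by omega)
  -- Stage $p_0-p+1$ is the first that settles position $p$; for $p>p_0$ the truncation gives stage
  -- $0$, which is the zero cochain.
  refine ⟨Cochain.mk fun p q hpq => (W (p₀ - p + 1).toNat).1.v p q hpq, ?_⟩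
  ext p q hpq
  rw [← (W (p₀ - p + 1).toNat).2 p q hpq (by omega), δ_v n m hnm _ p q hpq (q - 1) (p + 1) rfl rfl,
    δ_v n m hnm _ p q hpq (q - 1) (p + 1) rfl rfl, Cochain.mk_v, Cochain.mk_v,
    hW (p₀ - (p + 1) + 1).toNat (p₀ - p + 1).toNat (by omega) (p + 1) q (by omega) (by omega)]

/-- Cocycles of negative degree between a bounded above complex of projectives and a
complex that is exact in negative degrees are coboundaries. -/
theorem exists_δ_eq_of_neg [F.IsStrictlyLE 0] [∀ p, Projective (F.X p)] [G.IsGE 0] {n m : ℤ}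
    (hnm : n + 1 = m) (hm : m < 0) (z : Cochain F G m) (hz : δ m (m + 1) z = 0) :
    ∃ w : Cochain F G n, δ n m w = z :=
  exists_δ_eq_of_exactAt hnm z hz 0
    (fun p _ _ hp => (F.isZero_of_isStrictlyLE 0 p hp).eq_of_src _ _)
    (fun p _ => G.exactAt_of_isGE 0 (p + m) (by omega))

end Abelian

/-! ### Evaluation of $\operatorname{Hom}(F,F)\otimes G$ at a functional -/

section Evaluation

variable {R : Type u} [CommRing R] {F G : CochainComplex (ModuleCat.{u} R) ℤ}

open TensorProduct

/-- The map `θ ⊗ g ↦ (x ↦ φ (θ x) • g)`. -/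
noncomputable def evalTensor {s : ℤ} (φ : F.X s →ₗ[R] R) (a p : ℤ) (hp : p + a = s) (q : ℤ) :
    Cochain F F a ⊗[R] G.X q →ₗ[R] (F.X p ⟶ G.X q) :=
  TensorProduct.lift <| LinearMap.mk₂ R
    (fun θ g => ModuleCat.ofHom (LinearMap.toSpanSingleton R _ g ∘ₗ φ ∘ₗ (θ.v p s hp).hom))
    (fun _ _ _ => by ext; simp)
    (fun _ _ _ => by ext; simp [mul_smul])
    (fun _ _ _ => by ext; simp)
    (fun _ _ _ => by ext; exact smul_comm _ _ _)

@[simp]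
theorem evalTensor_tmul {s : ℤ} (φ : F.X s →ₗ[R] R) (a p : ℤ) (hp : p + a = s) (q : ℤ)
    (θ : Cochain F F a) (g : G.X q) (x : F.X p) :
    (evalTensor φ a p hp q (θ ⊗ₜ g)).hom x = φ ((θ.v p s hp).hom x) • g := rfl

theorem evalTensor_comp_d {s : ℤ} (φ : F.X s →ₗ[R] R) (a p : ℤ) (hp : p + a = s) (q q' : ℤ)
    (t : Cochain F F a ⊗[R] G.X q) :
    evalTensor φ a p hp q t ≫ G.d q q' =
      evalTensor φ a p hp q' ((G.d q q').hom.lTensor _ t) := by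
  induction t with
  | zero => simp
  | add x y hx hy => simp only [map_add, Preadditive.add_comp, hx, hy]
  | tmul θ g =>
    ext x
    simp

/-- Since $\varphi$ kills boundaries, only the half of $\partial\theta$ that precomposes with
$\partial^F$ survives. -/
theorem evalTensor_δ {s : ℤ} (φ : F.X s →ₗ[R] R) (hφ : φ ∘ₗ (F.d (s - 1) s).hom = 0)
    (a a' p p' : ℤ) (ha : a + 1 = a') (hp : p + a' = s) (hp' : p + 1 = p') (q : ℤ)
    (t : Cochain F F a ⊗[R] G.X q) :
    evalTensor φ a' p hp q ((δ_hom R F F a a').rTensor _ t) =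
      a'.negOnePow • F.d p p' ≫ evalTensor φ a p' (by omega) q t := by
  induction t with
  | zero => simp
  | add x y hx hy => simp only [map_add, Preadditive.comp_add, hx, hy, smul_add]
  | tmul θ g =>
    ext x
    have h0 (y) : φ ((F.d (s - 1) s).hom y) = 0 := congr($hφ y)
    rw [LinearMap.rTensor_tmul, evalTensor_tmul]
    change φ (((δ a a' θ).v p s hp).hom x) • g = _
    rw [δ_v a a' ha θ p s hp (s - 1) p' rfl hp']
    rcases Int.units_eq_one_or a'.negOnePow with h | h <;> simp [h, h0, Units.smul_def]

end Evaluation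

end StableCohomology

namespace StableCohomology

open CochainComplex.HomComplex

/-! ### Extending a single component to a cocycle -/

section Extension

variable {R : Type u} [CommRing R] {F G : CochainComplex (ModuleCat.{u} R) ℤ}

open TensorProduct

/-- $\operatorname{Hom}(F,F)$ is exact in negative degrees, and tensoring with a flat module
preserves this. -/
theorem exists_rTensor_δ_eq [F.IsStrictlyLE 0] [∀ p, Projective (F.X p)] [F.IsGE 0]
    (M : Type u) [AddCommGroup M] [Module R M] [Module.Flat R M] (a : ℤ) (ha : a < 0)
    (t : Cochain F F a ⊗[R] M) (ht : (δ_hom R F F a (a + 1)).rTensor M t = 0) :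
    ∃ t', (δ_hom R F F (a - 1) a).rTensor M t' = t := by
  have h : Function.Exact (δ_hom R F F (a - 1) a) (δ_hom R F F a (a + 1)) := fun z =>
    ⟨fun hz => exists_δ_eq_of_neg (by omega) ha z hz, by
      rintro ⟨w, rfl⟩
      exact δ_δ _ _ _ w⟩
  exact (Module.Flat.rTensor_exact M h t).1 ht

theorem exists_rTensor_δ_eq_id_tmul {I : Ideal R}
    (hI : ∀ r ∈ I, ∃ h : Cochain F F (-1), δ (-1) 0 h = r • Cochain.ofHom (𝟙 F))
    {M : Type u} [AddCommGroup M] [Module R M] (x : M) (hx : x ∈ I • (⊤ : Submodule R M)) :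
    ∃ t', (δ_hom R F F (-1) 0).rTensor M t' = Cochain.ofHom (𝟙 F) ⊗ₜ x := by
  induction hx using Submodule.smul_induction_on' with
  | smul r hr y _ =>
    obtain ⟨h, hh⟩ := hI r hr
    refine ⟨h ⊗ₜ y, ?_⟩
    rw [LinearMap.rTensor_tmul, tmul_smul, smul_tmul']
    exact congrArg (· ⊗ₜ[R] y) hh
  | add x _ y _ hx hy =>
    obtain ⟨t, ht⟩ := hx
    obtain ⟨t', ht'⟩ := hy
    exact ⟨t + t', by rw [map_add, ht, ht', tmul_add]⟩

/-- A cocycle that extends `x ↦ φ x • e`, constructed up to a given degree. -/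
theorem exists_partial_cocycle [F.IsStrictlyLE 0] [∀ p, Projective (F.X p)] [F.IsGE 0]
    [∀ q, Module.Flat R (G.X q)] {I : Ideal R}
    (hI : ∀ r ∈ I, ∃ h : Cochain F F (-1), δ (-1) 0 h = r • Cochain.ofHom (𝟙 F))
    (hG : ∀ q q' (x : G.X q), (G.d q q').hom x ∈ I • (⊤ : Submodule R (G.X q')))
    {s t n : ℤ} (hst : s + n = t) (φ : F.X s →ₗ[R] R) (hφ : φ ∘ₗ (F.d (s - 1) s).hom = 0)
    (e : G.X t) (c : ℕ) : ∀ (p q a : ℤ) (hp : p = s + c) (hq : q = t + c) (ha : a = -c),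
    ∃ (γ : Cochain F G n) (θ : Cochain F F a ⊗[R] G.X q) (ε : ℤˣ),
      γ.v s t hst = ModuleCat.ofHom (LinearMap.toSpanSingleton R _ e ∘ₗ φ) ∧
      (∀ p' q' h, p' < s → γ.v p' q' h = 0) ∧
      (∀ p' q' h, p < p' → γ.v p' q' h = 0) ∧
      γ.v p q (by omega) = ε • evalTensor φ a p (by omega) q θ ∧
      (∀ a' q', a' + 1 = a → q + 1 = q' → ∃ θ' : Cochain F F a' ⊗[R] G.X q',
        (δ_hom R F F a' a).rTensor _ θ' = (G.d q q').hom.lTensor _ θ) ∧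
      ∀ p' q' h, p' < p → (δ n (n + 1) γ).v p' q' h = 0 := by
  induction c with
  | zero =>
    intro p q a hp hq ha
    obtain rfl : p = s := by simpa using hp
    obtain rfl : q = t := by simpa using hq
    obtain rfl : a = 0 := by simpa using ha
    have hev : evalTensor (G := G) φ 0 p (by omega) q (Cochain.ofHom (𝟙 F) ⊗ₜ e) =
        ModuleCat.ofHom (LinearMap.toSpanSingleton R _ e ∘ₗ φ) := by
      ext x
      simp
    refine ⟨Cochain.single (ModuleCat.ofHom (LinearMap.toSpanSingleton R _ e ∘ₗ φ)) n,
      Cochain.ofHom (𝟙 F) ⊗ₜ e, 1, ?_, ?_, ?_, ?_, ?_, ?_⟩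
    · rw [Cochain.single_v]
    · exact fun p' q' h hp' => Cochain.single_v_eq_zero _ _ _ _ _ (by omega)
    · exact fun p' q' h hp' => Cochain.single_v_eq_zero _ _ _ _ _ (by omega)
    · rw [Cochain.single_v, one_smul, hev]
    · intro a' q' ha' _
      obtain rfl : a' = -1 := by omega
      rw [LinearMap.lTensor_tmul]
      exact exists_rTensor_δ_eq_id_tmul hI _ (hG _ _ _)
    · intro p' q' h hp'
      rw [δ_v n (n + 1) rfl _ p' q' h (q' - 1) (p' + 1) rfl rfl,
        Cochain.single_v_eq_zero _ _ _ _ _ (by omega)]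
      by_cases hp'' : p' = p - 1
      · obtain rfl : p = p' + 1 := by omega
        obtain rfl : q' = q := by omega
        rw [Cochain.single_v]
        have : F.d p' (p' + 1) ≫ ModuleCat.ofHom (LinearMap.toSpanSingleton R _ e ∘ₗ φ) = 0 := by
          ext x
          have h0 : φ ((F.d p' (p' + 1)).hom x) = 0 := by
            rw [add_sub_cancel_right] at hφ
            exact congr($hφ x)
          simp [h0]
        rw [this]
        simp
      · rw [Cochain.single_v_eq_zero _ _ _ _ _ (by omega)]
        simp
  | succ c ih =>
    intro p q a hp hq ha
    obtain ⟨b, rfl⟩ : ∃ b, q = b + 1 := ⟨q - 1, by omega⟩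
    obtain ⟨r, rfl⟩ : ∃ r, p = r + 1 := ⟨p - 1, by omega⟩
    obtain ⟨γ, θ, ε, h₁, h₂, h₃, h₄, h₅, h₆⟩ := ih r b (a + 1)
      (by push_cast at hp; omega) (by push_cast at hq; omega) (by push_cast at ha; omega)
    obtain ⟨θ', hθ'⟩ := h₅ a (b + 1) rfl rfl
    have hpq : r + 1 + n = b + 1 := by omega
    -- At position $r$ the old component contributes through $\partial^G$ and the new one through
    -- $\partial^F$; this sign makes them cancel.
    let ε' : ℤˣ := -((n + 1).negOnePow * ε * (a + 1).negOnePow)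
    refine ⟨γ + Cochain.single (ε' • evalTensor φ a (r + 1) (by omega) (b + 1) θ') n,
      θ', ε', ?_, ?_, ?_, ?_, ?_, ?_⟩
    · rw [Cochain.add_v, h₁, Cochain.single_v_eq_zero _ _ _ _ _ (by omega), add_zero]
    · intro p' q' h hp'
      rw [Cochain.add_v, h₂ _ _ _ hp',
        Cochain.single_v_eq_zero _ _ _ _ _ (by omega), add_zero]
    · intro p' q' h hp'
      rw [Cochain.add_v, h₃ _ _ _ (by omega), Cochain.single_v_eq_zero _ _ _ _ _ (by omega),
        add_zero]
    · rw [Cochain.add_v, h₃ _ _ _ (by omega), Cochain.single_v, zero_add]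
    · intro a' q' ha' hq'
      obtain rfl : a' = a - 1 := by omega
      -- The next correction exists because $(1\otimes\partial)\theta'$ is a cocycle: its boundary
      -- is $(1\otimes\partial)^2\theta=0$.
      refine exists_rTensor_δ_eq _ a (by omega) _ ?_
      rw [← LinearMap.comp_apply, LinearMap.rTensor_comp_lTensor, ← LinearMap.lTensor_comp_rTensor,
        LinearMap.comp_apply, hθ', ← LinearMap.comp_apply, ← LinearMap.lTensor_comp,
        ← ModuleCat.hom_comp, G.d_comp_d]
      simp
    · intro p' q' h hp'
      rw [δ_add, Cochain.add_v]
      by_cases hp'' : p' = r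
      · subst hp''
        obtain rfl : q' = b + 1 := by omega
        rw [δ_v n (n + 1) rfl γ p' (b + 1) h b (p' + 1) (by omega) rfl, h₃ (p' + 1) _ _ (by omega),
          δ_v n (n + 1) rfl _ p' (b + 1) h b (p' + 1) (by omega) rfl, Cochain.single_v,
          Cochain.single_v_eq_zero _ _ _ _ _ (by omega), h₄, Linear.units_smul_comp,
          evalTensor_comp_d, ← hθ', evalTensor_δ φ hφ a (a + 1) p' (p' + 1) rfl _ rfl]
        simp only [Limits.comp_zero, smul_zero, add_zero, Limits.zero_comp, zero_add,
          Linear.comp_units_smul, smul_smul, ε']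
        rw [mul_neg, Units.neg_smul, ← mul_assoc, ← mul_assoc, Int.units_mul_self, one_mul,
          add_neg_cancel]
      · rw [h₆ _ _ _ (by omega), δ_v n (n + 1) rfl _ p' q' h (q' - 1) (p' + 1) rfl rfl,
          Cochain.single_v_eq_zero _ _ _ _ _ (by omega),
          Cochain.single_v_eq_zero _ _ _ _ _ (by omega)]
        simp

/-- After $-t$ steps the remaining components of $\partial\gamma$ have target in positive degree,
where $G$ is zero. -/
theorem exists_cocycle_of_functional [F.IsStrictlyLE 0] [∀ p, Projective (F.X p)] [F.IsGE 0]
    [G.IsStrictlyLE 0] [∀ q, Module.Flat R (G.X q)] {I : Ideal R}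
    (hI : ∀ r ∈ I, ∃ h : Cochain F F (-1), δ (-1) 0 h = r • Cochain.ofHom (𝟙 F))
    (hG : ∀ q q' (x : G.X q), (G.d q q').hom x ∈ I • (⊤ : Submodule R (G.X q')))
    {s t n : ℤ} (hst : s + n = t) (φ : F.X s →ₗ[R] R) (hφ : φ ∘ₗ (F.d (s - 1) s).hom = 0)
    (e : G.X t) : ∃ γ : Cochain F G n, δ n (n + 1) γ = 0 ∧
      γ.v s t hst = ModuleCat.ofHom (LinearMap.toSpanSingleton R _ e ∘ₗ φ) ∧
      ∀ p q h, p < s → γ.v p q h = 0 := by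
  obtain ⟨γ, -, -, h₁, h₂, -, -, -, h₆⟩ :=
    exists_partial_cocycle hI hG hst φ hφ e (-t).toNat _ _ _ rfl rfl rfl
  refine ⟨γ, ?_, h₁, h₂⟩
  refine Cochain.ext _ _ fun p q h => ?_
  by_cases hp : p < s + (-t).toNat
  · exact h₆ p q h hp
  · rw [(G.isZero_of_isStrictlyLE 0 q).eq_of_tgt ((δ n (n + 1) γ).v p q h) 0,
      Cochain.zero_v]

/-- Every cocycle in the top component extends to a cocycle. -/
theorem exists_cocycle_extending [F.IsStrictlyLE 0] [∀ p, Projective (F.X p)] [F.IsGE 0]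
    [G.IsStrictlyLE 0] [∀ q, Module.Free R (G.X q)] [∀ q, Module.Finite R (G.X q)] {I : Ideal R}
    (hI : ∀ r ∈ I, ∃ h : Cochain F F (-1), δ (-1) 0 h = r • Cochain.ofHom (𝟙 F))
    (hG : ∀ q q' (x : G.X q), (G.d q q').hom x ∈ I • (⊤ : Submodule R (G.X q')))
    {s t n : ℤ} (hst : s + n = t) (β : F.X s ⟶ G.X t) (hβ : F.d (s - 1) s ≫ β = 0) :
    ∃ γ : Cochain F G n, δ n (n + 1) γ = 0 ∧ γ.v s t hst = β ∧
      ∀ p q h, p < s → γ.v p q h = 0 := by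
  -- A finite basis splits $\beta$ into functionals, each extended separately.
  let b := Module.Free.chooseBasis R (G.X t)
  have hφ (i) : (b.coord i ∘ₗ β.hom) ∘ₗ (F.d (s - 1) s).hom = 0 := by
    rw [LinearMap.comp_assoc, ← ModuleCat.hom_comp, hβ]
    simp
  choose γ h₁ h₂ h₃ using fun i => exists_cocycle_of_functional hI hG hst _ (hφ i) (b i)
  have hv (p q h) : (∑ i, γ i).v p q h = ∑ i, (γ i).v p q h :=
    map_sum (AddMonoidHom.mk' (fun z : Cochain F G n => z.v p q h) fun _ _ => rfl) _ _
  refine ⟨∑ i, γ i, ?_, ?_, fun p q h hp => ?_⟩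
  · exact (map_sum (δ_hom R F G n (n + 1)) _ _).trans (Finset.sum_eq_zero fun i _ => h₁ i)
  · rw [hv]
    simp only [h₂]
    ext x
    rw [ModuleCat.hom_sum, LinearMap.sum_apply]
    exact b.sum_repr _
  · rw [hv]
    exact Finset.sum_eq_zero fun i _ => h₃ i p q h hp

/-- If the differential of a bounded cochain starts in position `s`, then its component there is
a coboundary. -/
theorem exists_d_comp_eq_of_bounded [F.IsStrictlyLE 0] [∀ p, Projective (F.X p)] [F.IsGE 0]
    [G.IsStrictlyLE 0] [∀ q, Module.Free R (G.X q)] [∀ q, Module.Finite R (G.X q)] {I : Ideal R}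
    (hI : ∀ r ∈ I, ∃ h : Cochain F F (-1), δ (-1) 0 h = r • Cochain.ofHom (𝟙 F))
    (hG : ∀ q q' (x : G.X q), (G.d q q').hom x ∈ I • (⊤ : Submodule R (G.X q')))
    {s t n m : ℤ} (hnm : n + 1 = m) (hst : s + m = t) (η : Cochain F G n)
    (hη : η ∈ boundedCochains F G n) (hs : ∀ p q h, p < s → (δ n m η).v p q h = 0) :
    ∃ u : F.X (s + 1) ⟶ G.X t, F.d s (s + 1) ≫ u = (δ n m η).v s t hst := by
  obtain ⟨b, hb⟩ := hη
  -- The lowest component of $\eta'$ is a cocycle while its position is at most $s$; subtracting an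
  -- extension of it leaves $\partial\eta'$ unchanged and raises the support by one.
  have key (c : ℕ) : b + c ≤ s → ∃ η' : Cochain F G n, δ n m η' = δ n m η ∧
      ∀ p q h, p ≤ b + c → η'.v p q h = 0 := by
    induction c with
    | zero => exact fun _ => ⟨η, rfl, fun p q h hp => hb p q h (by simpa using hp)⟩
    | succ c ih =>
      intro hc
      obtain ⟨η', h₁, h₂⟩ := ih (by push_cast at hc; omega)
      obtain ⟨γ, h₃, h₄, h₅⟩ := exists_cocycle_extending hI hG (s := b + c + 1) rfl
        (η'.v (b + c + 1) _ rfl) (by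
          have := hs (b + c) (b + c + 1 + n) (by omega) (by push_cast at hc; omega)
          rw [← h₁, δ_v n m hnm _ _ _ _ (b + c + n) (b + c + 1) (by omega) rfl,
            h₂ _ _ _ le_rfl, Limits.zero_comp, zero_add] at this
          rw [add_sub_cancel_right]
          exact (smul_eq_zero_iff_eq _).1 this)
      refine ⟨η' - γ, by subst hnm; rw [δ_sub, h₁, h₃, sub_zero], fun p q h hp => ?_⟩
      rw [Cochain.sub_v]
      by_cases hp' : p = b + c + 1
      · subst hp' h
        rw [h₄, sub_self]
      · rw [h₂ _ _ _ (by push_cast at hp; omega), h₅ _ _ _ (by push_cast at hp; omega), sub_zero]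
  obtain ⟨η', h₁, h₂⟩ : ∃ η' : Cochain F G n, δ n m η' = δ n m η ∧
      ∀ p q h, p ≤ s → η'.v p q h = 0 := by
    by_cases hbs : b ≤ s
    · obtain ⟨η', h₁, h₂⟩ := key (s - b).toNat (by omega)
      exact ⟨η', h₁, fun p q h hp => h₂ p q h (by omega)⟩
    · exact ⟨η, rfl, fun p q h hp => hb p q h (by omega)⟩
  refine ⟨m.negOnePow • η'.v (s + 1) t (by omega), ?_⟩
  rw [← h₁, δ_v n m hnm _ _ _ _ (t - 1) (s + 1) rfl rfl, h₂ _ _ _ le_rfl]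
  simp

end Extension
end StableCohomology

namespace StableCohomology

open CochainComplex.HomComplex

/-! ### A uniform bound from finiteness of stable cohomology -/

section UniformBound

variable {R : Type u} [CommRing R] (F G : CochainComplex (ModuleCat.{u} R) ℤ)

/-- The cochains that vanish in all positions up to `b`. -/
def cochainsVanishingBelow (n b : ℤ) : Submodule R (Cochain F G n) where
  carrier := {β | ∀ p q hpq, p ≤ b → β.v p q hpq = 0}
  add_mem' hβ hγ p q hpq hp := by rw [Cochain.add_v, hβ p q hpq hp, hγ p q hpq hp, add_zero]
  zero_mem' _ _ _ _ := rfl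
  smul_mem' r β hβ p q hpq hp := by rw [Cochain.smul_v, hβ p q hpq hp, smul_zero]

variable {F G}

theorem cochainsVanishingBelow_anti (n : ℤ) :
    Antitone fun b => cochainsVanishingBelow F G n b :=
  fun _ _ h _ hβ p q hpq hp => hβ p q hpq (hp.trans h)

theorem exists_mem_cochainsVanishingBelow {n : ℤ} {β : Cochain F G n}
    (hβ : β ∈ boundedCochains F G n) :
    ∃ j : ℕ, β ∈ cochainsVanishingBelow F G n (-j) := by
  obtain ⟨b, hb⟩ := hβ
  exact ⟨(-b).toNat, fun p q hpq hp => hb p q hpq (by omega)⟩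

theorem comp_mem_boundedCochains {K : CochainComplex (ModuleCat.{u} R) ℤ} {n₁ n₂ n₃ : ℤ}
    {β : Cochain F G n₁} (hβ : β ∈ boundedCochains F G n₁) (γ : Cochain G K n₂)
    (h : n₁ + n₂ = n₃) : β.comp γ h ∈ boundedCochains F K n₃ := by
  obtain ⟨b, hb⟩ := hβ
  refine ⟨b, fun p q hpq hp => ?_⟩
  rw [Cochain.comp_v _ _ h p (p + n₁) q rfl (by omega), hb p _ rfl hp, Limits.zero_comp]

variable (F G)

/-- Every stable cocycle of degree `n` is stably cohomologous to one whose differential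
vanishes in all positions up to `-J`. -/
def HasUniformBound (n : ℤ) (J : ℕ) : Prop :=
  ∀ y : Cochain F G n, δ n (n + 1) y ∈ boundedCochains F G (n + 1) →
    ∃ (y' : Cochain F G n) (x : Cochain F G (n - 1)),
      δ n (n + 1) y' ∈ cochainsVanishingBelow F G (n + 1) (-J) ∧
      y - y' - δ (n - 1) n x ∈ boundedCochains F G n

/-- The class of a cochain that becomes a cocycle modulo bounded cochains. -/
def stableClass (n : ℤ) :
    (boundedCochains F G (n + 1)).comap (δ_hom R F G n (n + 1)) →ₗ[R] StableHomology F G n :=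
  Submodule.mkQ _ ∘ₗ ((boundedCochains F G n).mkQ ∘ₗ Submodule.subtype _).codRestrict
    (stableCocycles F G n) fun y => LinearMap.mem_ker.2 ((Submodule.Quotient.mk_eq_zero _).2 y.2)

theorem exists_of_stableClass_eq_zero {n : ℤ}
    (y : (boundedCochains F G (n + 1)).comap (δ_hom R F G n (n + 1)))
    (hy : stableClass F G n y = 0) :
    ∃ x : Cochain F G (n - 1), y.1 - δ (n - 1) n x ∈ boundedCochains F G n := by
  obtain ⟨x, hx⟩ := (Submodule.Quotient.mk_eq_zero _).1 hy
  obtain ⟨x, rfl⟩ := Submodule.Quotient.mk_surjective _ x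
  refine ⟨x, ?_⟩
  rw [← Submodule.Quotient.eq]
  exact hx.symm

/-- Filter the classes by how early the boundary of a representative vanishes. The ascending
filtration exhausts the module, so noetherianity makes one stage everything. -/
theorem exists_hasUniformBound (n : ℤ) [IsNoetherian R (StableHomology F G n)] :
    ∃ J, HasUniformBound F G n J := by
  let S : ℕ →o Submodule R (StableHomology F G n) :=
    ⟨fun j => (((cochainsVanishingBelow F G (n + 1) (-j)).comap
      (δ_hom R F G n (n + 1))).comap (Submodule.subtype _)).map (stableClass F G n),
      fun i j hij => Submodule.map_mono (Submodule.comap_mono (Submodule.comap_mono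
        (cochainsVanishingBelow_anti _ (by simpa using hij))))⟩
  obtain ⟨J, hJ⟩ := monotone_stabilizes_iff_noetherian.2 ‹_› S
  refine ⟨J, fun y hy => ?_⟩
  obtain ⟨j, hj⟩ := exists_mem_cochainsVanishingBelow hy
  have hmem : stableClass F G n ⟨y, hy⟩ ∈ S (max J j) :=
    S.monotone (le_max_right J j) ⟨⟨y, hy⟩, hj, rfl⟩
  rw [← hJ _ (le_max_left J j)] at hmem
  obtain ⟨y', hy', e⟩ := hmem
  obtain ⟨x, hx⟩ := exists_of_stableClass_eq_zero F G (⟨y, hy⟩ - y')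
    (by rw [map_sub, e, sub_self])
  exact ⟨y'.1, x, hy', hx⟩

variable {F G}

/-- Postcomposition does not move source positions, so the same $J$ serves; this permits passing to
the minimal resolution. -/
theorem HasUniformBound.of_homotopy {K : CochainComplex (ModuleCat.{u} R) ℤ} {n : ℤ} {J : ℕ}
    (h : HasUniformBound F G n J) (f : G ⟶ K) (g : K ⟶ G) (H : Homotopy (g ≫ f) (𝟙 K)) :
    HasUniformBound F K n J := by
  intro y hy
  have hδ {L L' : CochainComplex (ModuleCat.{u} R) ℤ} (i j : ℤ) (hij : i + 1 = j)
      (z : Cochain F L i) (φ : L ⟶ L') : δ i j (z.comp (Cochain.ofHom φ) (add_zero i)) =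
        (δ i j z).comp (Cochain.ofHom φ) (add_zero j) := by
    rw [δ_comp_zero_cochain _ _ _ hij, δ_ofHom, Cochain.comp_zero, zero_add]
  obtain ⟨y', x, hy', hx⟩ := h (y.comp (Cochain.ofHom g) (add_zero n)) (by
    rw [hδ _ _ rfl]
    exact comp_mem_boundedCochains hy _ _)
  have hH := δ_ofHomotopy H
  refine ⟨y'.comp (Cochain.ofHom f) (add_zero n), x.comp (Cochain.ofHom f) (add_zero _) -
    y.comp (Cochain.ofHomotopy H) (by omega), ?_, ?_⟩
  · rw [hδ _ _ rfl]
    intro p q hpq hp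
    rw [Cochain.comp_zero_cochain_v, hy' p q hpq hp, Limits.zero_comp]
  · have e : y - y'.comp (Cochain.ofHom f) (add_zero n) -
        δ (n - 1) n (x.comp (Cochain.ofHom f) (add_zero _) -
          y.comp (Cochain.ofHomotopy H) (by omega)) =
        (y.comp (Cochain.ofHom g) (add_zero n) - y' - δ (n - 1) n x).comp (Cochain.ofHom f)
          (add_zero n) - (δ n (n + 1) y).comp (Cochain.ofHomotopy H) (by omega) := by
      rw [δ_sub, hδ _ _ (by omega), δ_comp y (Cochain.ofHomotopy H) _ (n + 1) 0 n (by omega) rfl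
        (by omega), hH, Cochain.sub_comp, Cochain.sub_comp, Cochain.comp_sub, Cochain.comp_id,
        Cochain.ofHom_comp, Cochain.comp_assoc_of_second_is_zero_cochain]
      simp
      abel
    rw [e]
    exact sub_mem (comp_mem_boundedCochains hx _ _) (comp_mem_boundedCochains hy _ _)

end UniformBound

/-! ### Cocycles between resolutions and $\operatorname{Ext}$ -/

section Comparison

variable {R : Type u} [CommRing R] {M N : ModuleCat.{u} R} (P : ProjectiveResolution M)
  (Q : ProjectiveResolution N)

/-- The augmentation of a projective resolution. -/
noncomputable def augmentation : Q.cochainComplex.X 0 ⟶ N :=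
  (Q.cochainComplexXIso 0 0).hom ≫ Q.π.f 0

instance : Epi (augmentation Q) :=
  inferInstanceAs (Epi ((Q.cochainComplexXIso 0 0).hom ≫ Q.π.f 0))

theorem d_comp_augmentation : Q.cochainComplex.d (-1) 0 ≫ augmentation Q = 0 := by
  rw [Q.cochainComplex_d (-1) 0 1 0 rfl rfl, augmentation]
  simp
  exact Q.complex_d_comp_π_f_zero

theorem exists_lift_of_comp_augmentation_eq_zero {X : ModuleCat.{u} R} [Projective X]
    (f : X ⟶ Q.cochainComplex.X 0) (hf : f ≫ augmentation Q = 0) :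
    ∃ g : X ⟶ Q.cochainComplex.X (-1), g ≫ Q.cochainComplex.d (-1) 0 = f := by
  have hf' : (f ≫ (Q.cochainComplexXIso 0 0).hom) ≫ Q.π.f 0 = 0 := by
    rw [Category.assoc]
    exact hf
  refine ⟨Q.exact₀.liftFromProjective _ hf' ≫ (Q.cochainComplexXIso (-1) 1).inv, ?_⟩
  have := Q.exact₀.liftFromProjective_comp _ hf'
  dsimp at this
  rw [Q.cochainComplex_d (-1) 0 1 0 rfl rfl]
  simp [reassoc_of% this]

/-- A cocycle is a coboundary if its augmentation is one. -/
theorem exists_δ_eq_of_augmentation {F : CochainComplex (ModuleCat.{u} R) ℤ}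
    [∀ p, Projective (F.X p)] {n m s : ℤ} (hnm : n + 1 = m) (hs : s + m = 0)
    (z : Cochain F Q.cochainComplex m) (hz : δ m (m + 1) z = 0) (g : F.X (s + 1) ⟶ N)
    (hg : F.d s (s + 1) ≫ g = z.v s 0 hs ≫ augmentation Q) :
    ∃ w : Cochain F Q.cochainComplex n, δ n m w = z := by
  -- Removing the boundary of a lift of $g$ kills the augmentation; the rest takes values where the
  -- resolution is exact.
  let g' := Projective.factorThru g (augmentation Q)
  have hg' : g' ≫ augmentation Q = g := Projective.factorThru_comp _ _
  let z₁ := z - m.negOnePow • δ n m (Cochain.single g' n)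
  have hz₁ : z₁.v s 0 hs ≫ augmentation Q = 0 := by
    rw [Cochain.sub_v, Cochain.units_smul_v, δ_v n m hnm _ s 0 hs (-1) (s + 1) rfl rfl,
      Cochain.single_v, Cochain.single_v_eq_zero _ _ _ _ _ (by omega), Limits.zero_comp, zero_add,
      smul_smul, Int.units_mul_self, one_smul, Preadditive.sub_comp, ← hg, Category.assoc, hg',
      sub_self]
  obtain ⟨h, hh⟩ := exists_lift_of_comp_augmentation_eq_zero Q _ hz₁
  obtain ⟨w, hw⟩ := exists_δ_eq_of_exactAt hnm (z₁ - δ n m (Cochain.single h n))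
    (by simp [z₁, hz, δ_δ]) (s - 1) (fun p q hpq hp => by
      by_cases hps : p = s
      · subst hps
        obtain rfl : q = 0 := by omega
        rw [Cochain.sub_v, δ_single_v_self hnm h (by omega) hs, hh, sub_self]
      · exact (Q.cochainComplex.isZero_of_isStrictlyLE 0 q).eq_of_tgt _ _)
    (fun p hp => Q.cochainComplex.exactAt_of_isGE 0 _)
  exact ⟨w + Cochain.single h n + m.negOnePow • Cochain.single g' n, by
    simp only [δ_add, δ_units_smul, hw, z₁]
    abel⟩

open CategoryTheory.Abelian

/-- The component of a cocycle that determines its class. -/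
noncomputable def augmentedComponent {m : ℕ}
    (z : Cochain P.cochainComplex Q.cochainComplex (m : ℤ)) : P.complex.X m ⟶ N :=
  (P.cochainComplexXIso (-m) m).inv ≫ z.v (-m) 0 (by omega) ≫ augmentation Q

theorem d_comp_augmentedComponent {m : ℕ}
    (z : Cochain P.cochainComplex Q.cochainComplex (m : ℤ)) (hz : δ (m : ℤ) (m + 1) z = 0) :
    P.complex.d (m + 1) m ≫ augmentedComponent P Q z = 0 := by
  have h := Cochain.congr_v hz (-(m + 1 : ℕ)) 0 (by push_cast; omega)
  rw [δ_v (m : ℤ) (m + 1) rfl z _ _ _ (-1) (-m) rfl (by push_cast; omega), Cochain.zero_v] at h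
  have h' := congr($h ≫ augmentation Q)
  rw [Preadditive.add_comp, Category.assoc, d_comp_augmentation, Limits.comp_zero, zero_add,
    Linear.units_smul_comp, Limits.zero_comp, smul_eq_zero_iff_eq,
    P.cochainComplex_d _ _ (m + 1) m rfl rfl] at h'
  simp only [Category.assoc] at h'
  rw [← cancel_epi (P.cochainComplexXIso (-(m + 1 : ℕ)) (m + 1)).hom, Limits.comp_zero]
  exact h'

/-- The class in `Ext` of a cocycle between projective resolutions. -/
noncomputable def extClass (m : ℕ) :
    LinearMap.ker (δ_hom R P.cochainComplex Q.cochainComplex (m : ℤ) (m + 1)) →ₗ[R] Ext M N m where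
  toFun z := P.extMk (augmentedComponent P Q z.1) (m + 1) rfl (d_comp_augmentedComponent P Q _ z.2)
  map_add' z z' := by
    rw [P.add_extMk]
    congr 1
    simp [augmentedComponent]
  map_smul' r z := by
    rw [RingHom.id_apply, Ext.smul_eq_comp_mk₀, P.extMk_comp_mk₀]
    congr 1
    simp [augmentedComponent]

theorem exists_δ_eq_of_extClass_eq_zero {n : ℤ} (m : ℕ) (hnm : n + 1 = m)
    (z : LinearMap.ker (δ_hom R P.cochainComplex Q.cochainComplex (m : ℤ) (m + 1)))
    (hz : extClass P Q m z = 0) :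
    ∃ w : Cochain P.cochainComplex Q.cochainComplex n, δ n (m : ℤ) w = z.1 := by
  have h := congr(P.extEquivCohomologyClass $hz)
  change P.extEquivCohomologyClass (P.extMk (augmentedComponent P Q z.1) (m + 1) rfl
    (d_comp_augmentedComponent P Q _ z.2)) = _ at h
  rw [P.extEquivCohomologyClass_extMk, P.extEquivCohomologyClass_zero,
    CohomologyClass.mk_eq_zero_iff,
    Cocycle.toSingleMk_mem_coboundaries_iff _ _ _ _ _ (-m + 1) (by omega)] at h
  obtain ⟨g, hg⟩ := h
  refine exists_δ_eq_of_augmentation Q hnm (s := -m) (by omega) z.1 z.2 g ?_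
  rw [hg, augmentedComponent]
  simp

/-- Only a noetherian target that detects coboundaries is needed, so $0$ serves in negative degrees
and $\operatorname{Ext}^m$ in the others. -/
theorem exists_isNoetherian_cohomology [IsNoetherianRing R] [Module.Finite R M] [Module.Finite R N]
    {n m : ℤ} (hnm : n + 1 = m) :
    ∃ (E : Type u) (_ : AddCommGroup E) (_ : Module R E) (_ : IsNoetherian R E)
      (α : LinearMap.ker (δ_hom R P.cochainComplex Q.cochainComplex m (m + 1)) →ₗ[R] E),
      ∀ z, α z = 0 → ∃ w : Cochain P.cochainComplex Q.cochainComplex n, δ n m w = z.1 := by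
  by_cases hm : m < 0
  · exact ⟨PUnit, inferInstance, inferInstance, inferInstance, 0,
      fun z _ => exists_δ_eq_of_neg hnm hm z.1 z.2⟩
  · obtain ⟨m, rfl⟩ := Int.eq_ofNat_of_zero_le (not_lt.1 hm)
    exact ⟨Ext M N m, inferInstance, inferInstance, inferInstance, extClass P Q m,
      exists_δ_eq_of_extClass_eq_zero P Q m hnm⟩

end Comparison

end StableCohomology

namespace StableCohomology

open CochainComplex.HomComplex CategoryTheory.Abelian

/-! ### Passage to complexes indexed by the integers -/

section MinimalCochainComplex

variable {R : Type u} [CommRing R]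

theorem free_cochainComplex_X {N : ModuleCat.{u} R} (Q : ProjectiveResolution N)
    [∀ n, Module.Free R (Q.complex.X n)] (q : ℤ) : Module.Free R (Q.cochainComplex.X q) := by
  by_cases hq : q ≤ 0
  · obtain ⟨k, rfl⟩ := Int.exists_eq_neg_ofNat hq
    exact Module.Free.of_equiv (Q.cochainComplexXIso (-k) k).symm.toLinearEquiv
  · have := ModuleCat.subsingleton_of_isZero (Q.cochainComplex.isZero_of_isStrictlyLE 0 q)
    infer_instance

theorem finite_cochainComplex_X {N : ModuleCat.{u} R} (Q : ProjectiveResolution N)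
    [∀ n, Module.Finite R (Q.complex.X n)] (q : ℤ) : Module.Finite R (Q.cochainComplex.X q) := by
  by_cases hq : q ≤ 0
  · obtain ⟨k, rfl⟩ := Int.exists_eq_neg_ofNat hq
    exact Module.Finite.equiv (Q.cochainComplexXIso (-k) k).symm.toLinearEquiv
  · have := ModuleCat.subsingleton_of_isZero (Q.cochainComplex.isZero_of_isStrictlyLE 0 q)
    infer_instance

theorem cochainComplex_d_mem {N : ModuleCat.{u} R} (Q : ProjectiveResolution N) (I : Ideal R)
    (hI : ∀ n (x : Q.complex.X (n + 1)),
      (Q.complex.d (n + 1) n).hom x ∈ I • (⊤ : Submodule R (Q.complex.X n)))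
    (q q' : ℤ) (x : Q.cochainComplex.X q) :
    (Q.cochainComplex.d q q').hom x ∈ I • (⊤ : Submodule R (Q.cochainComplex.X q')) := by
  by_cases h : q + 1 = q'
  · by_cases hq : q' ≤ 0
    · obtain ⟨k, rfl⟩ := Int.exists_eq_neg_ofNat hq
      rw [Q.cochainComplex_d q (-k) (k + 1) k (by push_cast; omega) rfl]
      have := Submodule.mem_map_of_mem (f := (Q.cochainComplexXIso (-k) k).inv.hom)
        (hI k ((Q.cochainComplexXIso q (k + 1) (by push_cast; omega)).hom.hom x))
      rw [Submodule.map_smul''] at this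
      exact Submodule.smul_mono le_rfl le_top this
    · have := ModuleCat.subsingleton_of_isZero (Q.cochainComplex.isZero_of_isStrictlyLE 0 q')
      rw [Subsingleton.elim ((Q.cochainComplex.d q q').hom x) 0]
      exact Submodule.zero_mem _
  · rw [Q.cochainComplex.shape q q' (by simpa using h)]
    exact Submodule.zero_mem _

/-- Homotopy uniqueness of projective resolutions, for the cochain complexes. -/
theorem exists_homotopy_cochainComplex {N : ModuleCat.{u} R} (Q H : ProjectiveResolution N) :
    ∃ (f : Q.cochainComplex ⟶ H.cochainComplex) (g : H.cochainComplex ⟶ Q.cochainComplex),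
      Nonempty (Homotopy (g ≫ f) (𝟙 H.cochainComplex)) := by
  let e := ProjectiveResolution.homotopyEquiv Q H
  refine ⟨HomologicalComplex.extendMap e.hom ComplexShape.embeddingDownNat,
    HomologicalComplex.extendMap e.inv ComplexShape.embeddingDownNat, ⟨?_⟩⟩
  have h₁ := HomologicalComplex.extendMap_comp e.inv e.hom ComplexShape.embeddingDownNat
  have h₂ := HomologicalComplex.extendMap_id H.complex ComplexShape.embeddingDownNat
  exact (Homotopy.ofEq h₁.symm).trans
    ((e.homotopyInvHomId.extend ComplexShape.embeddingDownNat).trans (Homotopy.ofEq h₂))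

/-- A nonzero class in `Ext^i(M, R)` gives a cocycle that is not a coboundary. -/
theorem exists_functional {M : ModuleCat.{u} R} (P : ProjectiveResolution M) (i : ℕ) (hi : 0 < i)
    [Nontrivial (Ext M (ModuleCat.of R R) i)] :
    ∃ φ : P.cochainComplex.X (-i) ⟶ ModuleCat.of R R,
      P.cochainComplex.d (-i - 1) (-i) ≫ φ = 0 ∧
      ∀ g : P.cochainComplex.X (-i + 1) ⟶ ModuleCat.of R R,
        P.cochainComplex.d (-i) (-i + 1) ≫ g ≠ φ := by
  obtain ⟨x, hx⟩ := exists_ne (0 : Ext M (ModuleCat.of R R) i)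
  obtain ⟨f, hf, rfl⟩ := P.extMk_surjective x (i + 1) rfl
  refine ⟨(P.cochainComplexXIso (-i) i).hom ≫ f, ?_, fun g hg => hx ?_⟩
  · rw [P.cochainComplex_d (-i - 1) (-i) (i + 1) i (by push_cast; omega) rfl]
    simp [hf]
  · obtain ⟨k, rfl⟩ := Nat.exists_eq_add_of_lt hi
    rw [P.extMk_eq_zero_iff f _ rfl hf k (by omega)]
    refine ⟨(P.cochainComplexXIso _ k (by push_cast; omega)).inv ≫ g, ?_⟩
    rw [P.cochainComplex_d _ _ (0 + k + 1) k rfl (by push_cast; omega), Category.assoc,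
      Category.assoc] at hg
    exact (cancel_epi _).1 hg

end MinimalCochainComplex

/-! ### The contradiction -/

section Local

variable {R : Type u} [CommRing R] [IsLocalRing R]

theorem exists_δ_eq_smul_of_mem
    (P : ProjectiveResolution (ModuleCat.of R (IsLocalRing.ResidueField R))) (r : R)
    (hr : r ∈ IsLocalRing.maximalIdeal R) :
    ∃ h : Cochain P.cochainComplex P.cochainComplex (-1),
      δ (-1) 0 h = r • Cochain.ofHom (𝟙 P.cochainComplex) := by
  refine exists_δ_eq_smul P r fun m => ?_
  change r • (m : IsLocalRing.ResidueField R) = 0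
  rw [Algebra.smul_def, IsLocalRing.ResidueField.algebraMap_eq,
    (IsLocalRing.residue_eq_zero_iff r).2 hr, zero_mul]

theorem finite_stableExt {N : ModuleCat.{u} R}
    (P : ProjectiveResolution (ModuleCat.of R (IsLocalRing.ResidueField R)))
    (Q : ProjectiveResolution N) (n : ℤ)
    [FiniteDimensional (IsLocalRing.ResidueField R) (StableExt P Q n)] :
    Module.Finite R (StableExt P Q n) := by
  have : IsScalarTower R (IsLocalRing.ResidueField R) (StableExt P Q n) :=
    ⟨fun r a x => by
      rw [Algebra.smul_def, mul_smul]
      exact residue_smul_stableExt P Q n r _⟩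
  exact Module.Finite.trans (IsLocalRing.ResidueField R) _

theorem false_of_hasUniformBound [IsNoetherianRing R] {N : ModuleCat.{u} R} [Module.Finite R N]
    (P : ProjectiveResolution (ModuleCat.of R (IsLocalRing.ResidueField R)))
    (H : ProjectiveResolution N) [∀ n, Module.Free R (H.complex.X n)]
    [∀ n, Module.Finite R (H.complex.X n)] [∀ n, Nontrivial (H.complex.X n)]
    (hH : ∀ n (x : H.complex.X (n + 1)), (H.complex.d (n + 1) n).hom x ∈
      IsLocalRing.maximalIdeal R • (⊤ : Submodule R (H.complex.X n)))
    (hR : ¬ IsGorensteinLocalRing R) (n : ℤ) (J : ℕ)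
    (h : HasUniformBound P.cochainComplex H.cochainComplex n J) : False := by
  have hfree := free_cochainComplex_X H
  have hfin := finite_cochainComplex_X H
  have hd := cochainComplex_d_mem H _ hH
  have hP := exists_δ_eq_smul_of_mem P
  have : Module.Finite R (ModuleCat.of R (IsLocalRing.ResidueField R)) :=
    inferInstanceAs (Module.Finite R (IsLocalRing.ResidueField R))
  obtain ⟨E, _, _, _, α, hα⟩ := exists_isNoetherian_cohomology P H (n := n) (m := n + 1) rfl
  let S : ℕ →o Submodule R E :=
    ⟨fun j => ((cochainsVanishingBelow _ _ (n + 1) (-j)).comap (Submodule.subtype _)).map α,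
      fun i j hij => Submodule.map_mono (Submodule.comap_mono
        (cochainsVanishingBelow_anti _ (by simpa using hij)))⟩
  obtain ⟨J', hJ'⟩ := monotone_stabilizes_iff_noetherian.2 ‹_› S
  -- The index must exceed both stabilization bounds, be positive, and make the target index
  -- $k=i-(n+1)$ nonnegative, so that $H_k\ne0$.
  obtain ⟨i, hi, _⟩ := exists_nontrivial_ext_of_not_gorenstein hR (J + J' + (n + 1).toNat + 1)
  obtain ⟨φ, hφ, hφ'⟩ := exists_functional P i (by omega)
  obtain ⟨k, hk⟩ : ∃ k : ℕ, -(i : ℤ) + (n + 1) = -k := ⟨(i - (n + 1)).toNat, by omega⟩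
  have : Nontrivial (H.cochainComplex.X (-k)) :=
    (H.cochainComplexXIso (-k) k).toLinearEquiv.toEquiv.nontrivial
  let b := Module.Free.chooseBasis R (H.cochainComplex.X (-k))
  obtain ⟨i₀⟩ := b.index_nonempty
  obtain ⟨γ, hγ, hγs, hγ'⟩ := exists_cocycle_of_functional hP hd hk φ.hom
    congr(($hφ).hom) (b i₀)
  have hmem : α ⟨γ, hγ⟩ ∈ S (i + 1) :=
    ⟨⟨γ, hγ⟩, fun p q hpq hp => hγ' p q hpq (by push_cast at hp; omega), rfl⟩
  -- Stages $i+1$ and $i$ coincide, so $\gamma$ is cohomologous to a cocycle $\gamma'$ that vanishes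
  -- also at $-i$.
  rw [← hJ' (i + 1) (by omega), hJ' i (by omega)] at hmem
  obtain ⟨⟨γ', hγ₁⟩, hγ₂, hγ₃⟩ := hmem
  replace hγ₂ : γ' ∈ cochainsVanishingBelow _ _ (n + 1) (-i) := hγ₂
  obtain ⟨y, hy⟩ := hα (⟨γ, hγ⟩ - ⟨γ', hγ₁⟩) (by rw [map_sub, hγ₃, sub_self])
  change δ n (n + 1) y = γ - γ' at hy
  obtain ⟨y', x, hy', hx⟩ := h y (by
    rw [hy]
    exact sub_mem ⟨-i - 1, fun p q hpq hp => hγ' p q hpq (by omega)⟩ ⟨-i, hγ₂⟩)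
  -- At position $-i$ only $\gamma$ contributes to this boundary, and below it nothing does.
  have hη : δ n (n + 1) (y - y' - δ (n - 1) n x) = γ - γ' - δ n (n + 1) y' := by
    rw [δ_sub, δ_sub, δ_δ, sub_zero, hy]
  obtain ⟨u, hu⟩ := exists_d_comp_eq_of_bounded hP hd (s := -i) rfl hk _ hx
    (fun p q hpq hp => by
      rw [hη, Cochain.sub_v, Cochain.sub_v, hγ' _ _ _ hp, hγ₂ _ _ _ hp.le,
        hy' _ _ _ (by omega)]
      simp)
  rw [hη, Cochain.sub_v, Cochain.sub_v, hγs, hγ₂ _ _ _ le_rfl, hy' _ _ _ (by omega), sub_zero,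
    sub_zero] at hu
  -- The coordinate along $e$ recovers $\varphi$ and exhibits it as a coboundary.
  let ψ : H.cochainComplex.X (-k) ⟶ ModuleCat.of R R := ModuleCat.ofHom (b.coord i₀)
  refine hφ' (u ≫ ψ) ((Category.assoc _ _ _).symm.trans (congr($hu ≫ ψ).trans ?_))
  ext x
  change b.coord i₀ (φ.hom x • b i₀) = φ.hom x
  simp

end Local

end StableCohomology

theorem mainTheorem9 (R : Type u) [CommRing R] [IsLocalRing R] [IsNoetherianRing R]
    (N : Type u) [AddCommGroup N] [Module R N] [Module.Finite R N]
    (P : CategoryTheory.ProjectiveResolution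
      (ModuleCat.of R (IsLocalRing.ResidueField R)))
    (Q : CategoryTheory.ProjectiveResolution (ModuleCat.of R N))
    (h : ∃ n : ℤ, FiniteDimensional (IsLocalRing.ResidueField R)
      (StableCohomology.StableExt P Q n)) :
    HasFiniteProjectiveDimension R N ∨ IsGorensteinLocalRing R := by
  obtain ⟨n, hn⟩ := h
  by_contra! hc
  have := StableCohomology.finite_stableExt P Q n
  have : IsNoetherian R
      (StableCohomology.StableHomology P.cochainComplex Q.cochainComplex n) :=
    inferInstanceAs (IsNoetherian R (StableCohomology.StableExt P Q n))
  obtain ⟨J, hJ⟩ :=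
    StableCohomology.exists_hasUniformBound P.cochainComplex Q.cochainComplex n
  let H := StableCohomology.minimalResolution (R := R) N
  obtain ⟨f, g, ⟨e⟩⟩ := StableCohomology.exists_homotopy_cochainComplex Q H
  have (j : ℕ) : Nontrivial (H.complex.X j) :=
    StableCohomology.nontrivial_minimalResolution_X N hc.1 j
  have (j : ℕ) : Module.Free R (H.complex.X j) :=
    inferInstanceAs (Module.Free R ((StableCohomology.minimalComplex (R := R) N).X j))
  have (j : ℕ) : Module.Finite R (H.complex.X j) :=
    inferInstanceAs (Module.Finite R ((StableCohomology.minimalComplex (R := R) N).X j))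
  exact StableCohomology.false_of_hasUniformBound P H
    (StableCohomology.minimalResolution_d_mem N) hc.2 n J (hJ.of_homotopy f g e)
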